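/- Let $\mathfrak g$ be a finite-dimensional complex simple Lie algebra with Cartan subalgebra $\mathfrak h$, root system $\Phi\subset\mathfrak h^*$, Weyl group $W$ and base $\Delta=\{\alpha_1,\dots,\alpha_n\}$ of simple roots. Write $\tau_\alpha\in\mathfrak h$ for the coroot of $\alpha\in\Phi$. Let $\tilde\Lambda=\{\mu\in\mathfrak h^* : \mu(\tau_\alpha)\in\mathbb Z \text{ for all }\alpha\in\Phi\}$ be the lattice of abstract weights, let $\omega_1,\dots,\omega_n$ be the fundamental weights, $\omega_i(\tau_{\alpha_j})=\delta_{ij}$, and let $\beta_{\max}$ be the highest root. In type $C_n$ ($n\ge 2$) the simple roots are labelled in the standard order along the Dynkin diagram, with $\alpha_n$ the long simple root. Let $\mu\in\tilde\Lambda$ be an abstract weight. (1) For every integer $k$, there exist $\alpha,\beta\in\Phi$ with $2\mu=2k\alpha+\beta$ if and only if, for some $w\in W$ and some $l\in\{k,-k\}$, one of the following holds: - $\mathfrak g$ is of type $A_1$ and $w(\mu)=(2l+1)\,\omega_1$ (that is, $w(\mu)=2l+1$ when $\tilde\Lambda$ is identified with $\mathbb Z$ by $\omega_1\mapsto 1$);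 - $\mathfrak g$ is of type $C_n$ with $n\ge 3$ and $w(\mu)$ is one of $\omega_1+l\alpha_1$, $\omega_1+l\alpha_2$, $\omega_1+l\alpha_n$, $(2l+1)\omega_1=\omega_1+l\beta_{\max}$; - $\mathfrak g$ is of type $C_2$ and $w(\mu)$ is one of $\omega_1+l\alpha_1$, $\omega_1+l\alpha_2$, $(2l+1)\omega_1=\omega_1+l\beta_{\max}$. (2) In particular, $2\mu\in\Phi$ if and only if $\mathfrak g$ is of type $A_1$ or of type $C_n$ with $n\ge 2$, and $w(\mu)=\omega_1$ for some $w\in W$. -/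

import Mathlib

noncomputable section

namespace SimpleWeights

open LieAlgebra LieAlgebra.IsKilling Module

variable {𝔤 : Type*} [LieRing 𝔤] [LieAlgebra ℂ 𝔤] [FiniteDimensional ℂ 𝔤] [IsKilling ℂ 𝔤]
variable (H : LieSubalgebra ℂ 𝔤) [H.IsCartanSubalgebra]

/-- The lattice of abstract weights: the linear forms on the Cartan subalgebra `H` which take
integer values on all coroots. -/
def abstractWeights : AddSubgroup (Dual ℂ H) where
  carrier := {μ | ∀ α : H.root, ∃ m : ℤ, μ ((rootSystem H).coroot α) = m}
  zero_mem' := fun _ => ⟨0, by simp⟩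
  add_mem' := by
    intro x y hx hy α
    obtain ⟨m, hm⟩ := hx α
    obtain ⟨n, hn⟩ := hy α
    exact ⟨m + n, by rw [LinearMap.add_apply, hm, hn]; push_cast; rfl⟩
  neg_mem' := by
    intro x hx α
    obtain ⟨m, hm⟩ := hx α
    exact ⟨-m, by rw [LinearMap.neg_apply, hm]; push_cast; rfl⟩

variable {H}

/-- The fundamental weight attached to a simple root `α i`: the simple coroots form a basis of `H`,
and the fundamental weights form the dual basis of the dual space of `H`. -/
def fundamentalWeight (b : (rootSystem H).Base) (i : b.support) : Dual ℂ H :=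
  b.toCoweightBasis.coord i

theorem fundamentalWeight_coroot_self (b : (rootSystem H).Base) (i : b.support) :
    fundamentalWeight b i ((rootSystem H).coroot i) = 1 := by
  have h : (rootSystem H).coroot i = b.toCoweightBasis i := (b.toCoweightBasis_apply i).symm
  rw [h, fundamentalWeight, Basis.coord_apply, Basis.repr_self, Finsupp.single_eq_same]

theorem fundamentalWeight_coroot_of_ne (b : (rootSystem H).Base) (i j : b.support) (hij : i ≠ j) :
    fundamentalWeight b i ((rootSystem H).coroot j) = 0 := by
  have h : (rootSystem H).coroot j = b.toCoweightBasis j := (b.toCoweightBasis_apply j).symm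
  rw [h, fundamentalWeight, Basis.coord_apply, Basis.repr_self, Finsupp.single_eq_of_ne hij]

/-- The labelling `e 0, …, e (n - 1)` of the simple roots has Cartan matrix `A`; here the `(i, j)`
entry of the Cartan matrix is the value of the `i`-th simple root on the `j`-th simple coroot.
For `A = CartanMatrix.C n` this says that the root system has type `Cₙ`, that the simple roots are
labelled in the usual order along the Dynkin diagram, and that `e (n - 1)` is the long one. -/
def IsLabelling (b : (rootSystem H).Base) {n : ℕ} (A : Matrix (Fin n) (Fin n) ℤ)
    (e : Fin n ≃ b.support) : Prop :=
  ∀ i j, b.cartanMatrix (e i) (e j) = A i j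

/-- `β` is the highest root: `β - γ` is a sum of simple roots for every root `γ`. -/
def IsHighestRoot (b : (rootSystem H).Base) (β : H.root) : Prop :=
  ∀ γ : H.root, (rootSystem H).root β - (rootSystem H).root γ ∈
    AddSubmonoid.closure ((rootSystem H).root '' b.support)

/-- The list of weights in type `A₁`, with parameter `k`: the weight `(2k + 1) ω₁`. -/
def IsListedA₁ (b : (rootSystem H).Base) (k : ℤ) (ν : Dual ℂ H) : Prop :=
  ∃ e : Fin 1 ≃ b.support, IsLabelling b (CartanMatrix.A 1) e ∧
    ν = (2 * k + 1) • fundamentalWeight b (e 0)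

/-- The list of weights in type `Cₙ`, `n ≥ 3`, with parameter `k`: the weights `ω₁ + k α₁`,
`ω₁ + k α₂`, `ω₁ + k αₙ` and `(2k + 1) ω₁ = ω₁ + k β_max`. -/
def IsListedC (b : (rootSystem H).Base) (k : ℤ) (ν : Dual ℂ H) : Prop :=
  ∃ (n : ℕ) (hn : 3 ≤ n) (e : Fin n ≃ b.support), IsLabelling b (CartanMatrix.C n) e ∧
    (ν = fundamentalWeight b (e ⟨0, by omega⟩) + k • (rootSystem H).root (e ⟨0, by omega⟩) ∨
     ν = fundamentalWeight b (e ⟨0, by omega⟩) + k • (rootSystem H).root (e ⟨1, by omega⟩) ∨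
     ν = fundamentalWeight b (e ⟨0, by omega⟩) + k • (rootSystem H).root (e ⟨n - 1, by omega⟩) ∨
     (ν = (2 * k + 1) • fundamentalWeight b (e ⟨0, by omega⟩) ∧
      ∃ β : H.root, IsHighestRoot b β ∧
        ν = fundamentalWeight b (e ⟨0, by omega⟩) + k • (rootSystem H).root β))

/-- The list of weights in type `C₂`, with parameter `k`: the weights `ω₁ + k α₁`, `ω₁ + k α₂` and
`(2k + 1) ω₁ = ω₁ + k β_max`. -/
def IsListedC₂ (b : (rootSystem H).Base) (k : ℤ) (ν : Dual ℂ H) : Prop :=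
  ∃ e : Fin 2 ≃ b.support, IsLabelling b (CartanMatrix.C 2) e ∧
    (ν = fundamentalWeight b (e 0) + k • (rootSystem H).root (e 0) ∨
     ν = fundamentalWeight b (e 0) + k • (rootSystem H).root (e 1) ∨
     (ν = (2 * k + 1) • fundamentalWeight b (e 0) ∧
      ∃ β : H.root, IsHighestRoot b β ∧
        ν = fundamentalWeight b (e 0) + k • (rootSystem H).root β))

end SimpleWeights

end

/-! Pairing `2μ = 2kα + β` with a coroot shows that `β` has only even pairings
(`isEvenRoot_of_two_smul_eq`). An even root forces type C, with A₁ as rank one. Distinct even roots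
are orthogonal up to sign, and by irreducibility they span, so the halves `f p` of the positive ones
form a basis. Expanding the other roots in it shows that the roots are exactly `±2 f p` and `±f p ±
f q` (`isFrame_halfRoot`).

The Weyl group contains all signed permutations of the `f p`. One of them moves `β` to `2 f 0`. The
permutations and sign changes fixing `f 0` then move `α`, up to a sign absorbed into `l = ±k`, to `2
f 0`, `f 0 - f 1`, `f 1 - f 2` or `2 f (m - 1)` (`exists_normal_form`).

Ordering the frame by decreasing height makes the simple roots `f p - f (p + 1)` and the last `2 f
p` (`exists_root_eq_simple`). Hence `f 0` is the first fundamental weight and the four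
representatives are `β_max`, `α₁`, `α₂`, `αₙ`.

Conversely, in type C twice the first fundamental weight is a root
(`exists_root_eq_two_mul_fundamental`), so applying `w⁻¹` to a listed weight recovers `α` and `β`.
Part (2) is the case `k = 0`. -/

noncomputable section

namespace RootPairing

open Module Set Submodule

variable {ι K M N : Type*} [Field K] [CharZero K] [AddCommGroup M] [Module K M]
  [AddCommGroup N] [Module K N] (P : RootPairing ι K M N)

/-! ### Roots with only even pairings -/

section Even

variable [P.IsCrystallographic]

/-- A root all of whose pairings with coroots are even. -/
def IsEvenRoot (i : ι) : Prop := ∀ j, Even (P.pairingIn ℤ i j)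

variable {P}

lemma IsEvenRoot.reflectionPerm {i : ι} (hi : P.IsEvenRoot i) (j : ι) :
    P.IsEvenRoot (P.reflectionPerm j i) := by
  intro k
  rw [← P.pairingIn_reflectionPerm]
  exact hi _

omit [CharZero K] in
lemma pairing_eq_intCast (i j : ι) : P.pairing i j = (P.pairingIn ℤ i j : K) := by
  rw [← P.algebraMap_pairingIn ℤ]; simp

lemma pairingIn_eq_zero_comm [Finite ι] (i j : ι) :
    P.pairingIn ℤ i j = 0 ↔ P.pairingIn ℤ j i = 0 := by
  have := P.pairingIn_pairingIn_mem_set_of_isCrystallographic i j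
  simp only [mem_insert_iff, mem_singleton_iff, Prod.mk.injEq] at this
  omega

variable [Finite ι] [P.IsReduced]

/-- Among the possible pairs of Cartan integers of two non-proportional roots, only `(0, 0)` and
`±(2, 1)` have an even first entry. -/
lemma IsEvenRoot.pairingIn_cases {i : ι} (hi : P.IsEvenRoot i) {j : ι} (hij : i ≠ j)
    (hij' : P.root i ≠ -P.root j) :
    P.pairingIn ℤ i j = 2 * P.pairingIn ℤ j i ∧
      (P.pairingIn ℤ j i = 0 ∨ P.pairingIn ℤ j i = 1 ∨ P.pairingIn ℤ j i = -1) := by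
  have := P.pairingIn_pairingIn_mem_set_of_isCrystal_of_isRed' i j (by simpa using hij) hij'
  simp only [mem_insert_iff, mem_singleton_iff, Prod.mk.injEq] at this
  have := hi j
  rw [Int.even_iff] at this
  omega

lemma IsEvenRoot.pairingIn_eq_zero {i j : ι} (hi : P.IsEvenRoot i) (hj : P.IsEvenRoot j)
    (hij : i ≠ j) (hij' : P.root i ≠ -P.root j) :
    P.pairingIn ℤ i j = 0 := by
  have h₁ := hi.pairingIn_cases hij hij'
  have h₂ := hj.pairingIn_cases hij.symm (fun h ↦ hij' (by rw [h, neg_neg]))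
  omega

end Even

/-! ### Coordinates of type C -/

section Frame

/-- A basis of the weight space (indexed by `κ`) in which the roots are the vectors `± 2 f p` and
`± f p ± f q` for `p ≠ q`. -/
structure IsFrame {κ : Type*} [DecidableEq κ] (f : κ → M) : Prop where
  top_le_span : ⊤ ≤ span K (range f)
  root_cases : ∀ i, (∃ p, P.root i = (2 : K) • f p ∨ P.root i = -((2 : K) • f p)) ∨
    ∃ p q, p ≠ q ∧
      (P.root i = f p - f q ∨ P.root i = f p + f q ∨ P.root i = -(f p + f q))
  exists_long : ∀ p, ∃ i, P.root i = (2 : K) • f p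
  exists_sub : ∀ p q, p ≠ q → ∃ i, P.root i = f p - f q
  exists_add : ∀ p q, p ≠ q → ∃ i, P.root i = f p + f q
  coroot_long : ∀ i p, P.root i = (2 : K) • f p →
    ∀ r, P.coroot' i (f r) = if r = p then 1 else 0
  coroot_sub : ∀ i p q, p ≠ q → P.root i = f p - f q →
    ∀ r, P.coroot' i (f r) = (if r = p then 1 else 0) - if r = q then 1 else 0

end Frame

/-! ### An even root produces a frame -/

section Existence

variable [Finite ι] [P.IsCrystallographic] [P.IsIrreducible]

/-- If a root `j` is not orthogonal to a member `i` of the set, then `s_j i` is again a member and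
`i - s_j i` is a nonzero multiple of `j`. So roots outside the span are orthogonal to the set, and
irreducibility applies. The linking condition is carried along for `exists_linked`. -/
lemma span_even_linked_eq_top {p : ι} (hp : P.IsEvenRoot p) :
    span K (P.root '' {k | P.IsEvenRoot k ∧
      ∃ γ, P.pairingIn ℤ γ p ≠ 0 ∧ P.pairingIn ℤ γ k ≠ 0}) = ⊤ := by
  apply P.span_root_image_eq_top_of_forall_orthogonal
  · exact ⟨p, hp, p, by simp, by simp⟩
  · intro j hj i ⟨hi, γ, hγp, hγi⟩
    by_contra hji
    have hij : P.pairingIn ℤ i j ≠ 0 := by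
      intro h
      have h' := (pairingIn_eq_zero_comm (P := P) i j).1 h
      apply hji
      rw [IsOrthogonal, pairing_eq_intCast, pairing_eq_intCast, h, h']
      simp
    have hmem : P.reflectionPerm j i ∈ {k | P.IsEvenRoot k ∧
        ∃ γ, P.pairingIn ℤ γ p ≠ 0 ∧ P.pairingIn ℤ γ k ≠ 0} := by
      refine ⟨hi.reflectionPerm j, ?_⟩
      -- If `j` is orthogonal to `p`, then `s_j` fixes `p` and `s_j γ` is a link; otherwise `j`
      -- itself is one.
      by_cases hjp : P.pairingIn ℤ j p = 0
      · refine ⟨P.reflectionPerm j γ, ?_, ?_⟩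
        · have : P.reflectionPerm j p = p := by
            apply P.root.injective
            rw [root_reflectionPerm, reflection_apply_root, pairing_eq_intCast,
              (pairingIn_eq_zero_comm (P := P) p j).2 hjp]
            simp
          rwa [← P.pairingIn_reflectionPerm, this]
        · rwa [← P.pairingIn_reflectionPerm, reflectionPerm_self]
      · refine ⟨j, hjp, ?_⟩
        rw [P.pairingIn_reflectionPerm, pairingIn_reflectionPerm_self_left, neg_ne_zero]
        rwa [ne_eq, pairingIn_eq_zero_comm]
    apply hj
    have h₁ := subset_span (R := K) (mem_image_of_mem P.root hmem)
    have h₂ := subset_span (R := K) (mem_image_of_mem P.root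
      (show i ∈ {k | P.IsEvenRoot k ∧ ∃ γ, P.pairingIn ℤ γ p ≠ 0 ∧ P.pairingIn ℤ γ k ≠ 0} from
        ⟨hi, γ, hγp, hγi⟩))
    rw [root_reflectionPerm, reflection_apply_root] at h₁
    have h₃ := sub_mem h₂ h₁
    rw [sub_sub_cancel] at h₃
    refine (smul_mem_iff _ ?_).1 h₃
    rw [pairing_eq_intCast]
    exact_mod_cast hij

variable {P} [P.IsReduced] (b : P.Base)

/-- The positive even roots. -/
abbrev posEven : Type _ := {i : ι // P.IsEvenRoot i ∧ b.IsPos i}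

omit [Finite ι] [P.IsIrreducible] [P.IsReduced] in
lemma posEven_ne_neg {p q : posEven b} : P.root p ≠ -P.root q := by
  let := P.indexNeg
  intro h
  have h₁ : (p : ι) = -(q : ι) := P.root_eq_neg_iff.1 h
  have := (Base.IsPos.neg_iff_not b (q : ι)).1 (h₁ ▸ p.2.2)
  exact this q.2.2

omit [P.IsIrreducible] in
lemma posEven_pairingIn [DecidableEq ι] (p q : posEven b) :
    P.pairingIn ℤ p q = if p = q then 2 else 0 := by
  split_ifs with h
  · rw [h]; simp
  · exact p.2.1.pairingIn_eq_zero q.2.1 (fun h' ↦ h (Subtype.ext h')) (posEven_ne_neg b)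

omit [Finite ι] [P.IsIrreducible] [P.IsReduced] in
lemma IsEvenRoot.exists_posEven {i : ι} (hi : P.IsEvenRoot i) :
    ∃ p : posEven b, P.root i = P.root p ∨ P.root i = -P.root p := by
  let := P.indexNeg
  rcases Base.IsPos.or_neg b i with h | h
  · exact ⟨⟨i, hi, h⟩, .inl rfl⟩
  · exact ⟨⟨-i, hi.reflectionPerm i, h⟩, .inr (by simp)⟩

/-- Half of a positive even root. -/
def halfRoot (p : posEven b) : M := (2 : K)⁻¹ • P.root p

omit [Finite ι] [P.IsIrreducible] [P.IsReduced] in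
lemma two_smul_halfRoot (p : posEven b) : (2 : K) • halfRoot b p = P.root p := by
  rw [halfRoot, smul_smul, mul_inv_cancel₀ two_ne_zero, one_smul]

omit [P.IsIrreducible] in
lemma coroot'_halfRoot [DecidableEq ι] (p q : posEven b) :
    P.coroot' q (halfRoot b p) = if p = q then 1 else 0 := by
  rw [halfRoot, map_smul, root_coroot'_eq_pairing, pairing_eq_intCast, posEven_pairingIn]
  split_ifs <;> simp

omit [P.IsReduced] in
lemma top_le_span_halfRoot {p : ι} (hp : P.IsEvenRoot p) :
    ⊤ ≤ span K (range (halfRoot b)) := by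
  rw [← P.span_even_linked_eq_top hp, span_le]
  rintro - ⟨k, ⟨hk, -⟩, rfl⟩
  obtain ⟨q, hq | hq⟩ := hk.exists_posEven b
  · rw [SetLike.mem_coe, hq, ← two_smul_halfRoot]
    exact smul_mem _ _ (subset_span (mem_range_self q))
  · rw [SetLike.mem_coe, hq, ← two_smul_halfRoot]
    exact neg_mem (smul_mem _ _ (subset_span (mem_range_self q)))

/-- Otherwise every even root linked to `p` differs from `±q`, hence is orthogonal to `q`; but these
roots span, and `q` pairs to 2 with itself. -/
lemma exists_linked {p q : posEven b} :
    ∃ γ, P.pairingIn ℤ γ p ≠ 0 ∧ P.pairingIn ℤ γ q ≠ 0 := by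
  by_contra hcon
  suffices h : span K (P.root '' {k | P.IsEvenRoot k ∧
      ∃ γ, P.pairingIn ℤ γ p ≠ 0 ∧ P.pairingIn ℤ γ k ≠ 0}) ≤ LinearMap.ker (P.coroot' q) by
    rw [P.span_even_linked_eq_top p.2.1] at h
    have := h (mem_top (x := P.root q))
    simp at this
  rw [span_le]
  rintro - ⟨k, ⟨hk, γ, hγp, hγk⟩, rfl⟩
  rw [SetLike.mem_coe, LinearMap.mem_ker, root_coroot'_eq_pairing, pairing_eq_intCast]
  have : P.pairingIn ℤ k q = 0 := by
    apply hk.pairingIn_eq_zero q.2.1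
    · rintro rfl
      exact hcon ⟨γ, hγp, hγk⟩
    · intro h
      rw [P.root_eq_neg_iff] at h
      refine hcon ⟨γ, hγp, fun h' ↦ hγk ?_⟩
      rw [h, pairingIn_reflectionPerm_self_right, h', neg_zero]
  simp [this]

variable [Fintype (posEven b)]

lemma eq_sum_halfRoot {p : ι} (hp : P.IsEvenRoot p) (x : M) :
    x = ∑ q : posEven b, P.coroot' q x • halfRoot b q := by
  classical
  have hx := top_le_span_halfRoot b hp (mem_top (x := x))
  induction hx using span_induction with
  | mem x h =>
    obtain ⟨r, rfl⟩ := h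
    simp_rw [coroot'_halfRoot]
    simp
  | zero => simp
  | add x y _ _ hx hy =>
    simp only [map_add, add_smul, Finset.sum_add_distrib]
    rw [← hx, ← hy]
  | smul a x _ hx =>
    simp only [map_smul, smul_eq_mul, mul_smul, ← Finset.smul_sum]
    rw [← hx]

omit [P.IsIrreducible] [Fintype (posEven b)] in
lemma pairingIn_halfRoot_of_not_even {j : ι} (hj : ¬ P.IsEvenRoot j) (q : posEven b) :
    P.pairingIn ℤ q j = 2 * P.pairingIn ℤ j q ∧
      (P.pairingIn ℤ j q = 0 ∨ P.pairingIn ℤ j q = 1 ∨ P.pairingIn ℤ j q = -1) := by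
  apply q.2.1.pairingIn_cases
  · rintro rfl; exact hj q.2.1
  · intro h
    have h' := P.root_eq_neg_iff.1 (neg_eq_iff_eq_neg.2 h).symm
    exact hj (h' ▸ q.2.1.reflectionPerm _)

omit [P.IsIrreducible] [Fintype (posEven b)] in
-- The coroot of a short root has the same coordinates as the root: the factor 2 between the two
-- pairings cancels the half.
lemma coroot'_halfRoot_of_not_even {j : ι} (hj : ¬ P.IsEvenRoot j) (q : posEven b) :
    P.coroot' j (halfRoot b q) = (P.pairingIn ℤ j q : K) := by
  rw [halfRoot, map_smul, root_coroot'_eq_pairing, pairing_eq_intCast,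
    (pairingIn_halfRoot_of_not_even b hj q).1]
  push_cast
  simp

/-- A root which is not even has exactly two nonzero coordinates, each `1` or `-1`. -/
lemma exists_two_of_not_even {p : ι} (hp : P.IsEvenRoot p) {j : ι} (hj : ¬ P.IsEvenRoot j) :
    ∃ q r : posEven b, q ≠ r ∧ (P.pairingIn ℤ j q = 1 ∨ P.pairingIn ℤ j q = -1) ∧
      (P.pairingIn ℤ j r = 1 ∨ P.pairingIn ℤ j r = -1) ∧
      (∀ s : posEven b, P.pairingIn ℤ j s ≠ 0 → s = q ∨ s = r) ∧
      P.root j = (P.pairingIn ℤ j q : K) • halfRoot b q +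
        (P.pairingIn ℤ j r : K) • halfRoot b r := by
  classical
  have hc := fun q ↦ (pairingIn_halfRoot_of_not_even b hj q).2
  have hsum := eq_sum_halfRoot b hp (P.root j)
  simp only [root_coroot'_eq_pairing, pairing_eq_intCast] at hsum
  -- Pairing the expansion of `j` with its own coroot gives `2 = ∑ c_q²` with every `c_q` in `{0, 1,
  -- -1}`.
  have hcard : (Finset.univ.filter fun q : posEven b ↦ P.pairingIn ℤ j q ≠ 0).card = 2 := by
    have h₁ := congrArg (P.coroot' j) hsum
    simp only [root_coroot'_eq_pairing, pairing_same, map_sum, map_smul,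
      coroot'_halfRoot_of_not_even b hj, smul_eq_mul] at h₁
    have h₂ : (2 : ℤ) = ∑ q : posEven b, P.pairingIn ℤ j q * P.pairingIn ℤ j q := by
      exact_mod_cast h₁
    have h₃ : ∀ q : posEven b, P.pairingIn ℤ j q * P.pairingIn ℤ j q =
        if P.pairingIn ℤ j q ≠ 0 then 1 else 0 := by
      intro q
      rcases hc q with h | h | h <;> simp [h]
    rw [Finset.sum_congr rfl (fun q _ ↦ h₃ q), Finset.sum_boole] at h₂
    exact_mod_cast h₂.symm
  obtain ⟨q, r, hqr, hqr'⟩ := Finset.card_eq_two.1 hcard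
  have hmem : ∀ s : posEven b, P.pairingIn ℤ j s ≠ 0 ↔ s = q ∨ s = r := by
    intro s
    have := Finset.ext_iff.1 hqr' s
    simpa using this
  refine ⟨q, r, hqr, ?_, ?_, fun s ↦ (hmem s).1, ?_⟩
  · have := (hmem q).2 (.inl rfl); have := hc q; tauto
  · have := (hmem r).2 (.inr rfl); have := hc r; tauto
  · rw [← Finset.sum_pair hqr (f := fun q : posEven b ↦ (P.pairingIn ℤ j q : K) • halfRoot b q),
      ← hqr']
    conv_lhs => rw [hsum]
    symm
    apply Finset.sum_filter_of_ne
    intro x _ hx h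
    simp [h] at hx

omit [P.IsIrreducible] [Fintype (posEven b)] in
lemma reflection_halfRoot [DecidableEq ι] (p q : posEven b) :
    P.reflection q (halfRoot b p) = if p = q then -halfRoot b p else halfRoot b p := by
  rw [reflection_apply, coroot'_halfRoot]
  split_ifs with h
  · subst h
    rw [one_smul, ← two_smul_halfRoot]
    module
  · simp

/-- A root linking `q` and `r` cannot be even, so its two nonzero coordinates are at `q` and `r`.
Reflections in `q` and `r` flip these signs independently. -/
lemma exists_root_eq_signed_sum {q r : posEven b} (hqr : q ≠ r) :
    (∃ i, P.root i = halfRoot b q - halfRoot b r) ∧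
      ∃ i, P.root i = halfRoot b q + halfRoot b r := by
  classical
  obtain ⟨j, hjq, hjr⟩ := exists_linked b (p := q) (q := r)
  have hj : ¬ P.IsEvenRoot j := by
    intro hj
    obtain ⟨p, hp⟩ := hj.exists_posEven b
    have key : ∀ s : posEven b, P.pairingIn ℤ j s ≠ 0 → p = s := by
      intro s hs
      by_contra hps
      have h0 := posEven_pairingIn b p s
      rw [if_neg hps] at h0
      rcases hp with hp | hp
      · exact hs (by rw [P.root.injective hp, h0])
      · rw [P.root_eq_neg_iff] at hp
        exact hs (by rw [hp, pairingIn_reflectionPerm_self_left, h0, neg_zero])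
    exact hqr ((key q hjq).symm.trans (key r hjr))
  obtain ⟨q', r', hqr', hq, hr, hs, hroot⟩ := exists_two_of_not_even b q.2.1 hj
  have hdiff : (P.root j = halfRoot b q + halfRoot b r ∨ P.root j = halfRoot b q - halfRoot b r) ∨
      P.root j = -halfRoot b q + halfRoot b r ∨ P.root j = -halfRoot b q - halfRoot b r := by
    rcases hs q hjq with rfl | rfl <;> rcases hs r hjr with rfl | rfl
    · exact absurd rfl hqr
    · rcases hq with hq | hq <;> rcases hr with hr | hr <;> rw [hq, hr] at hroot <;>
        simp only [Int.cast_one, Int.cast_neg, one_smul, neg_smul, ← sub_eq_add_neg] at hroot <;>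
        tauto
    · rcases hq with hq | hq <;> rcases hr with hr | hr <;> rw [hq, hr, add_comm] at hroot <;>
        simp only [Int.cast_one, Int.cast_neg, one_smul, neg_smul, ← sub_eq_add_neg] at hroot <;>
        tauto
    · exact absurd rfl hqr
  have hr' := fun x ↦ P.root_reflectionPerm (r : ι) x
  have hq' := fun x ↦ P.root_reflectionPerm (q : ι) x
  have h₁ := reflection_halfRoot b q r
  have h₂ := reflection_halfRoot b r q
  have h₃ := reflection_halfRoot b q q
  have h₄ := reflection_halfRoot b r r
  simp only [hqr, hqr.symm, if_true, if_false] at h₁ h₂ h₃ h₄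
  rcases hdiff with (h | h) | h | h
  · exact ⟨⟨_, (hr' j).trans (by rw [h, map_add, h₁, h₄, sub_eq_add_neg])⟩, j, h⟩
  · exact ⟨⟨j, h⟩, _, (hr' j).trans (by rw [h, map_sub, h₁, h₄, sub_neg_eq_add])⟩
  · refine ⟨⟨_, (hr' (P.reflectionPerm q j)).trans (?_ : _ = _)⟩, _, (hq' j).trans (?_ : _ = _)⟩
    · rw [hq', h]
      simp only [map_add, map_neg, h₁, h₂, h₃, h₄]
      module
    · rw [h]
      simp only [map_add, map_neg, h₂, h₃]
      module
  · refine ⟨⟨_, (hq' j).trans (?_ : _ = _)⟩, _, (hr' (P.reflectionPerm q j)).trans (?_ : _ = _)⟩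
    · rw [h]
      simp only [map_sub, map_neg, h₂, h₃]
      module
    · rw [hq', h]
      simp only [map_sub, map_neg, h₁, h₂, h₃, h₄]
      module

omit [Fintype (posEven b)] in
/-- If there is an even root then the halves of the positive even roots form a frame. -/
lemma isFrame_halfRoot [DecidableEq ι] {p : ι} (hp : P.IsEvenRoot p) :
    P.IsFrame (halfRoot b) where
  top_le_span := top_le_span_halfRoot b hp
  root_cases i := by
    have := Fintype.ofFinite (posEven b)
    by_cases hi : P.IsEvenRoot i
    · left
      obtain ⟨q, hq⟩ := hi.exists_posEven b
      exact ⟨q, by rwa [two_smul_halfRoot]⟩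
    · right
      obtain ⟨q, r, hqr, hq, hr, -, hroot⟩ := exists_two_of_not_even b hp hi
      rcases hq with hq | hq <;> rcases hr with hr | hr <;> rw [hq, hr] at hroot <;>
        simp only [Int.cast_one, Int.cast_neg, one_smul, neg_smul] at hroot
      · exact ⟨q, r, hqr, .inr (.inl hroot)⟩
      · exact ⟨q, r, hqr, .inl (by rw [hroot, sub_eq_add_neg])⟩
      · exact ⟨r, q, hqr.symm, .inl (by rw [hroot]; abel)⟩
      · exact ⟨q, r, hqr, .inr (.inr (by rw [hroot]; abel))⟩
  exists_long q := ⟨q, (two_smul_halfRoot b q).symm⟩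
  exists_sub q r hqr := by
    have := Fintype.ofFinite (posEven b)
    exact (exists_root_eq_signed_sum b hqr).1
  exists_add q r hqr := by
    have := Fintype.ofFinite (posEven b)
    exact (exists_root_eq_signed_sum b hqr).2
  coroot_long i q hi r := by
    rw [two_smul_halfRoot] at hi
    rw [P.root.injective hi, coroot'_halfRoot]
  coroot_sub i q r hqr hi s := by
    have := Fintype.ofFinite (posEven b)
    have hc : ∀ s : posEven b, (P.pairingIn ℤ i s : K) =
        (if s = q then 1 else 0) - if s = r then 1 else 0 := by
      intro s
      rw [← pairing_eq_intCast, ← root_coroot'_eq_pairing, hi, map_sub, coroot'_halfRoot,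
        coroot'_halfRoot]
      simp only [eq_comm]
    have hi' : ¬ P.IsEvenRoot i := by
      intro hi'
      have h₁ := hc q
      rw [if_pos rfl, if_neg hqr, sub_zero] at h₁
      have h₂ : P.pairingIn ℤ i q = 1 := by exact_mod_cast h₁
      have := hi' q
      rw [h₂] at this
      exact absurd this (by decide)
    rw [coroot'_halfRoot_of_not_even b hi', hc]

end Existence

end RootPairing

end

noncomputable section

namespace RootPairing

open Module Set Submodule

variable {ι K M N : Type*} [Field K] [AddCommGroup M] [Module K M]
  [AddCommGroup N] [Module K N] {P : RootPairing ι K M N}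

lemma weylGroup_smul_zsmul (w : P.weylGroup) (k : ℤ) (x : M) : w • (k • x) = k • (w • x) :=
  map_zsmul (DistribSMul.toAddMonoidHom M w) k x

/-! ### Signed permutations of a frame in the Weyl group -/

namespace IsFrame

section

variable {κ : Type*} [DecidableEq κ] {f : κ → M} (hf : P.IsFrame f)

include hf

lemma exists_weylGroup_neg (p : κ) :
    ∃ w : P.weylGroup, w • f p = -f p ∧ ∀ r, r ≠ p → w • f r = f r := by
  obtain ⟨i, hi⟩ := hf.exists_long p
  refine ⟨weylGroup.ofIdx P i, ?_, fun r hr ↦ ?_⟩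
  · rw [weylGroup.ofIdx_smul, Equiv.reflection_smul, reflection_apply, hf.coroot_long i p hi,
      if_pos rfl, hi]
    module
  · rw [weylGroup.ofIdx_smul, Equiv.reflection_smul, reflection_apply, hf.coroot_long i p hi,
      if_neg hr, zero_smul, sub_zero]

lemma exists_weylGroup_swap (p q : κ) :
    ∃ w : P.weylGroup, ∀ r, w • f r = f (Equiv.swap p q r) := by
  rcases eq_or_ne p q with rfl | hpq
  · exact ⟨1, by simp⟩
  obtain ⟨i, hi⟩ := hf.exists_sub p q hpq
  refine ⟨weylGroup.ofIdx P i, fun r ↦ ?_⟩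
  rw [weylGroup.ofIdx_smul, Equiv.reflection_smul, reflection_apply, hf.coroot_sub i p q hpq hi, hi]
  rcases eq_or_ne r p with rfl | hrp
  · simp [hpq]
  · rcases eq_or_ne r q with rfl | hrq
    · simp [hrp]
    · simp [hrp, hrq, Equiv.swap_apply_of_ne_of_ne]

lemma exists_weylGroup_perm [Finite κ] (σ : Equiv.Perm κ) :
    ∃ w : P.weylGroup, ∀ r, w • f r = f (σ r) := by
  induction σ using Equiv.Perm.swap_induction_on with
  | one => exact ⟨1, by simp⟩
  | swap_mul σ x y _ ih =>
    obtain ⟨w, hw⟩ := ih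
    obtain ⟨w', hw'⟩ := hf.exists_weylGroup_swap x y
    exact ⟨w' * w, fun r ↦ by rw [mul_smul, hw, hw']; rfl⟩

lemma linearIndependent : LinearIndependent K f := by
  rw [linearIndependent_iff']
  intro s g hg p hp
  obtain ⟨i, hi⟩ := hf.exists_long p
  have := congrArg (P.coroot' i) hg
  rw [map_sum, map_zero] at this
  simp only [map_smul, hf.coroot_long i p hi, smul_eq_mul, mul_ite, mul_one, mul_zero,
    Finset.sum_ite_eq', hp, if_true] at this
  exact this

lemma reindex {κ' : Type*} [DecidableEq κ'] (σ : κ' ≃ κ) : P.IsFrame (f ∘ σ) where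
  top_le_span := by rw [EquivLike.range_comp]; exact hf.top_le_span
  root_cases i := by
    rcases hf.root_cases i with ⟨p, hp⟩ | ⟨p, q, hpq, h⟩
    · exact .inl ⟨σ.symm p, by simpa using hp⟩
    · exact .inr ⟨σ.symm p, σ.symm q, by simpa using hpq, by simpa using h⟩
  exists_long p := hf.exists_long (σ p)
  exists_sub p q hpq := hf.exists_sub (σ p) (σ q) (by simpa using hpq)
  exists_add p q hpq := hf.exists_add (σ p) (σ q) (by simpa using hpq)
  coroot_long i p hi r := by simpa using hf.coroot_long i (σ p) hi (σ r)
  coroot_sub i p q hpq hi r := by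
    simpa using hf.coroot_sub i (σ p) (σ q) (by simpa using hpq) hi (σ r)

end

/-! ### Normal forms under the stabilizer of `f 0` -/

section Normal

variable {m : ℕ} {f : Fin m → M}

/-- Representatives, up to sign, of the orbits of roots under the stabilizer of `f 0`. -/
def IsRepresentative (f : Fin m → M) (hm : 0 < m) (x : M) : Prop :=
  x = (2 : K) • f ⟨0, hm⟩ ∨ (∃ h : 1 < m, x = f ⟨0, hm⟩ - f ⟨1, h⟩) ∨
    (∃ h : 2 < m, x = f ⟨1, by omega⟩ - f ⟨2, h⟩) ∨
    1 < m ∧ x = (2 : K) • f ⟨m - 1, by omega⟩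

variable (hf : P.IsFrame f) (hm : 0 < m)

include hf

lemma exists_representative_sub {p q : Fin m} (hpq : p ≠ q) :
    ∃ w : P.weylGroup, w • f ⟨0, hm⟩ = f ⟨0, hm⟩ ∧ ∃ ε : ℤ, (ε = 1 ∨ ε = -1) ∧
      ∃ x, IsRepresentative (K := K) f hm x ∧ w • (f p - f q) = ε • x := by
  by_cases hp : p = ⟨0, hm⟩
  · have hq : q ≠ ⟨0, hm⟩ := fun h ↦ hpq (hp.trans h.symm)
    have h1 : 1 < m := by simp only [ne_eq, Fin.ext_iff] at hq; omega
    obtain ⟨w, hw⟩ := hf.exists_weylGroup_perm (Equiv.swap q ⟨1, h1⟩)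
    have h0 : w • f ⟨0, hm⟩ = f ⟨0, hm⟩ := by
      rw [hw, Equiv.swap_apply_of_ne_of_ne hq.symm (by simp)]
    refine ⟨w, h0, 1, .inl rfl, _, .inr (.inl ⟨h1, rfl⟩), ?_⟩
    rw [smul_sub, hp, h0, hw, Equiv.swap_apply_left, one_smul]
  by_cases hq : q = ⟨0, hm⟩
  · have h1 : 1 < m := by simp only [Fin.ext_iff] at hp; omega
    obtain ⟨w, hw⟩ := hf.exists_weylGroup_perm (Equiv.swap p ⟨1, h1⟩)
    have h0 : w • f ⟨0, hm⟩ = f ⟨0, hm⟩ := by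
      rw [hw, Equiv.swap_apply_of_ne_of_ne (Ne.symm hp) (by simp)]
    refine ⟨w, h0, -1, .inr rfl, _, .inr (.inl ⟨h1, rfl⟩), ?_⟩
    rw [smul_sub, hq, h0, hw, Equiv.swap_apply_left]
    simp
  have h2 : 2 < m := by simp only [ne_eq, Fin.ext_iff] at hp hq hpq; omega
  -- Moving `p` to 1 may displace `q`, so the second swap acts on the image of `q`.
  obtain ⟨w, hw⟩ := hf.exists_weylGroup_perm
    (Equiv.swap (Equiv.swap p ⟨1, by omega⟩ q) ⟨2, h2⟩ * Equiv.swap p ⟨1, by omega⟩)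
  have hz : Equiv.swap p ⟨1, by omega⟩ ⟨0, hm⟩ = ⟨0, hm⟩ :=
    Equiv.swap_apply_of_ne_of_ne (Ne.symm hp) (by simp)
  have hq1 : Equiv.swap p ⟨1, by omega⟩ q ≠ ⟨1, by omega⟩ := by
    rw [ne_eq, Equiv.swap_apply_eq_iff, Equiv.swap_apply_right]
    exact hpq.symm
  have hq0 : Equiv.swap p ⟨1, by omega⟩ q ≠ ⟨0, hm⟩ := by
    rw [ne_eq, Equiv.swap_apply_eq_iff, hz]
    exact hq
  refine ⟨w, ?_, 1, .inl rfl, _, .inr (.inr (.inl ⟨h2, rfl⟩)), ?_⟩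
  · rw [hw, Equiv.Perm.mul_apply, hz, Equiv.swap_apply_of_ne_of_ne hq0.symm (by simp)]
  · rw [smul_sub, hw, hw, Equiv.Perm.mul_apply, Equiv.Perm.mul_apply, Equiv.swap_apply_left,
      Equiv.swap_apply_left, Equiv.swap_apply_of_ne_of_ne hq1.symm (by simp), one_smul]

lemma exists_representative_add {p q : Fin m} (hpq : p ≠ q) :
    ∃ w : P.weylGroup, w • f ⟨0, hm⟩ = f ⟨0, hm⟩ ∧ ∃ ε : ℤ, (ε = 1 ∨ ε = -1) ∧
      ∃ x, IsRepresentative (K := K) f hm x ∧ w • (f p + f q) = ε • x := by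
  -- The sum becomes a difference on changing the sign of `f q`, which fixes `f 0` only if `q ≠ 0`.
  wlog hq : q ≠ ⟨0, hm⟩ generalizing p q
  · rw [add_comm]
    exact this hpq.symm (fun hp ↦ hpq (by rw [hp, not_ne_iff.1 hq]))
  obtain ⟨w', h₁, h₂⟩ := hf.exists_weylGroup_neg q
  obtain ⟨w, h0, ε, hε, x, hx, h⟩ := hf.exists_representative_sub hm hpq
  refine ⟨w * w', by rw [mul_smul, h₂ _ hq.symm, h0], ε, hε, x, hx, ?_⟩
  rw [mul_smul, smul_add w', h₁, h₂ p hpq, ← sub_eq_add_neg, h]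

lemma exists_representative_long (p : Fin m) :
    ∃ w : P.weylGroup, w • f ⟨0, hm⟩ = f ⟨0, hm⟩ ∧ ∃ x, IsRepresentative (K := K) f hm x ∧
      w • ((2 : K) • f p) = x := by
  by_cases hp : p = ⟨0, hm⟩
  · exact ⟨1, one_smul _ _, _, .inl rfl, by rw [one_smul, hp]⟩
  have h1 : 1 < m := by simp only [Fin.ext_iff] at hp; omega
  obtain ⟨w, hw⟩ := hf.exists_weylGroup_perm (Equiv.swap p ⟨m - 1, by omega⟩)
  refine ⟨w, ?_, _, .inr (.inr (.inr ⟨h1, rfl⟩)), ?_⟩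
  · rw [hw, Equiv.swap_apply_of_ne_of_ne (Ne.symm hp) (by simp [Fin.ext_iff]; omega)]
  · rw [smul_comm, hw, Equiv.swap_apply_left]

lemma exists_representative (i : ι) :
    ∃ w : P.weylGroup, w • f ⟨0, hm⟩ = f ⟨0, hm⟩ ∧ ∃ ε : ℤ, (ε = 1 ∨ ε = -1) ∧
      ∃ x, IsRepresentative (K := K) f hm x ∧ w • P.root i = ε • x := by
  rcases hf.root_cases i with ⟨p, h | h⟩ | ⟨p, q, hpq, h | h | h⟩
  · obtain ⟨w, h0, x, hx, hw⟩ := hf.exists_representative_long hm p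
    exact ⟨w, h0, 1, .inl rfl, x, hx, by rw [h, hw, one_smul]⟩
  · obtain ⟨w, h0, x, hx, hw⟩ := hf.exists_representative_long hm p
    exact ⟨w, h0, -1, .inr rfl, x, hx, by rw [h, smul_neg, hw, neg_smul, one_smul]⟩
  · rw [h]
    exact hf.exists_representative_sub hm hpq
  · rw [h]
    exact hf.exists_representative_add hm hpq
  · obtain ⟨w, h0, ε, hε, x, hx, hw⟩ := hf.exists_representative_add hm hpq
    exact ⟨w, h0, -ε, by omega, x, hx, by rw [h, smul_neg, hw, neg_smul]⟩

lemma exists_weylGroup_smul_eq (p : Fin m) :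
    (∃ w : P.weylGroup, w • f p = f ⟨0, hm⟩) ∧ ∃ w : P.weylGroup, w • (-f p) = f ⟨0, hm⟩ := by
  obtain ⟨w, hw⟩ := hf.exists_weylGroup_swap p ⟨0, hm⟩
  obtain ⟨w', hw', -⟩ := hf.exists_weylGroup_neg p
  have h : w • f p = f ⟨0, hm⟩ := by rw [hw, Equiv.swap_apply_left]
  exact ⟨⟨w, h⟩, w * w', by rw [mul_smul, smul_neg, hw', neg_neg, h]⟩

/-- Normal form, up to the Weyl group, of a solution `μ` of `2 μ = 2 k α + β` with `β` even. -/
lemma exists_normal_form [CharZero K] [P.IsCrystallographic] {μ : M} {k : ℤ} {i j : ι}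
    (hj : P.IsEvenRoot j) (hμ : (2 : ℤ) • μ = (2 * k) • P.root i + P.root j) :
    ∃ w : P.weylGroup, ∃ l : ℤ, (l = k ∨ l = -k) ∧ ∃ x, IsRepresentative (K := K) f hm x ∧
      w • μ = f ⟨0, hm⟩ + l • x := by
  -- A root `±f p ± f q` pairs to `±1` with the coroot of `2 f p`, so an even root must be some `±2
  -- f p`.
  have hpos : ∃ w : P.weylGroup, w • P.root j = (2 : ℤ) • f ⟨0, hm⟩ := by
    rcases hf.root_cases j with ⟨p, h | h⟩ | ⟨p, q, hpq, h⟩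
    · obtain ⟨w, hw⟩ := (hf.exists_weylGroup_smul_eq hm p).1
      exact ⟨w, by rw [h, smul_comm, hw]; module⟩
    · obtain ⟨w, hw⟩ := (hf.exists_weylGroup_smul_eq hm p).2
      exact ⟨w, by rw [h, ← smul_neg, smul_comm, hw]; module⟩
    · exfalso
      obtain ⟨r, hr⟩ := hf.exists_long p
      have h₁ : P.pairing j r = 1 ∨ P.pairing j r = -1 := by
        rw [← root_coroot'_eq_pairing]
        rcases h with h | h | h <;> rw [h] <;>
          simp only [map_sub, map_add, map_neg, hf.coroot_long r p hr, if_true, if_neg hpq.symm] <;>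
          simp
      have h₂ : P.pairingIn ℤ j r = 1 ∨ P.pairingIn ℤ j r = -1 := by
        rw [pairing_eq_intCast] at h₁
        exact_mod_cast h₁
      have := hj r
      rw [Int.even_iff] at this
      omega
  obtain ⟨w, hw⟩ := hpos
  obtain ⟨w', h0, ε, hε, x, hx, hw'⟩ := hf.exists_representative hm (P.weylGroupToPerm w i)
  rw [← weylGroup_apply_root] at hw'
  refine ⟨w' * w, k * ε, by rcases hε with rfl | rfl <;> simp, x, hx, ?_⟩
  have h := congrArg (fun y ↦ w' • w • y) hμ
  simp only [smul_add, weylGroup_smul_zsmul, hw, hw', h0] at h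
  have h2 : (2 : K) • ((w' * w) • μ) = (2 : K) • (f ⟨0, hm⟩ + (k * ε) • x) := by
    rw [mul_smul]
    generalize w' • w • μ = y at h ⊢
    calc (2 : K) • y = (2 : ℤ) • y := by module
      _ = _ := h
      _ = _ := by module
  exact smul_right_injective M (two_ne_zero (α := K)) h2

end Normal

end IsFrame

end RootPairing

end

/-! ### Heights, and the match between frame and base -/

noncomputable section

namespace RootPairing

open Module Set Submodule

variable {ι K M N : Type*} [Field K] [CharZero K] [AddCommGroup M] [Module K M]
  [AddCommGroup N] [Module K N] {P : RootPairing ι K M N}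

lemma Base.height_eq_neg (b : P.Base) {i j : ι} (h : P.root i = -P.root j) :
    b.height i = -b.height j := by
  rw [P.root_eq_neg_iff.1 h]
  exact b.height_reflectionPerm_self j

lemma Base.IsPos.root_mem_closure [Finite ι] [P.IsCrystallographic] {b : P.Base} {i : ι}
    (hi : b.IsPos i) : P.root i ∈ AddSubmonoid.closure (P.root '' b.support) :=
  hi.induction_on_add (p := fun i ↦ P.root i ∈ AddSubmonoid.closure (P.root '' b.support))
    (fun i hi ↦ AddSubmonoid.subset_closure ⟨i, hi, rfl⟩)
    (fun i j k hk hi hj ↦ by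
      rw [hk]
      exact add_mem hi (AddSubmonoid.subset_closure ⟨j, hj, rfl⟩))

/-- A frame ordered by decreasing height. -/
structure IsSortedFrame (b : P.Base) {m : ℕ} (f : Fin m → M) (η : Fin m → ℤ) : Prop
    extends P.IsFrame f where
  height_long : ∀ i p, P.root i = (2 : K) • f p → b.height i = η p
  pos : ∀ p, 0 < η p
  anti : StrictAnti η

lemma IsFrame.two_mul_height_sub {κ : Type*} [DecidableEq κ] {f : κ → M}
    (b : P.Base) {i j k : ι} {p q : κ} (hi : P.root i = (2 : K) • f p)
    (hj : P.root j = (2 : K) • f q) (hk : P.root k = f p - f q) :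
    2 * b.height k = b.height i - b.height j := by
  have : P.root i = P.root j + (2 : ℤ) • P.root k := by rw [hi, hj, hk]; module
  have := b.height_add_zsmul this
  rw [smul_eq_mul] at this
  omega

/-- The positive even roots, ordered by height, give a sorted frame. -/
lemma exists_isSortedFrame [Finite ι] [P.IsCrystallographic] [P.IsReduced] [P.IsIrreducible]
    (b : P.Base) {p : ι} (hp : P.IsEvenRoot p) :
    ∃ (m : ℕ) (_ : 0 < m) (f : Fin m → M) (η : Fin m → ℤ), IsSortedFrame b f η := by
  classical
  have := Fintype.ofFinite (posEven b)
  have hf := isFrame_halfRoot b hp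
  -- Equal heights would make the root `f q - f r` have height zero. The minus sign makes the
  -- resulting order one of decreasing height.
  have hinj : Function.Injective fun q : posEven b ↦ -b.height (q : ι) := by
    intro q r hqr
    by_contra hne
    obtain ⟨k, hk⟩ := hf.exists_sub q r hne
    have h := IsFrame.two_mul_height_sub b (two_smul_halfRoot b q).symm
      (two_smul_halfRoot b r).symm hk
    have := b.height_ne_zero k
    simp only [neg_inj] at hqr
    omega
  let _ : LinearOrder (posEven b) := LinearOrder.lift' _ hinj
  let σ := Fintype.orderIsoFinOfCardEq (posEven b) rfl
  obtain ⟨q, -⟩ := hp.exists_posEven b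
  refine ⟨_, Fintype.card_pos_iff.2 ⟨q⟩, halfRoot b ∘ σ.toEquiv, fun r ↦ b.height (σ r : ι),
    hf.reindex σ.toEquiv, ?_, fun r ↦ (σ r).2.2, ?_⟩
  · intro i r hi
    rw [Function.comp_apply, two_smul_halfRoot] at hi
    rw [P.root.injective hi]
    rfl
  · intro r s hrs
    have : -b.height (σ r : ι) < -b.height (σ s : ι) := σ.strictMono hrs
    simpa using this

namespace IsSortedFrame

variable {b : P.Base} {m : ℕ} {f : Fin m → M} {η : Fin m → ℤ} (hf : IsSortedFrame b f η)

include hf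

lemma height_sub {k : ι} {p q : Fin m} (hk : P.root k = f p - f q) :
    2 * b.height k = η p - η q := by
  obtain ⟨i, hi⟩ := hf.exists_long p
  obtain ⟨j, hj⟩ := hf.exists_long q
  rw [IsFrame.two_mul_height_sub b hi hj hk, hf.height_long i p hi, hf.height_long j q hj]

lemma height_add {k : ι} {p q : Fin m} (hpq : p ≠ q) (hk : P.root k = f p + f q) :
    2 * b.height k = η p + η q := by
  obtain ⟨i, hi⟩ := hf.exists_sub p q hpq
  obtain ⟨j, hj⟩ := hf.exists_long q
  have h : P.root k = P.root i + P.root j := by rw [hi, hj, hk]; module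
  rw [b.height_add h, mul_add, hf.height_sub hi, hf.height_long j q hj]
  ring

/-- The difference is positive, and even because it is twice the height of a root. -/
lemma two_le_sub {p q : Fin m} (hpq : p < q) : η q + 2 ≤ η p := by
  obtain ⟨k, hk⟩ := hf.exists_sub p q hpq.ne
  have h₁ := hf.height_sub hk
  have h₂ := hf.anti hpq
  omega

omit hf in
/-- The simple roots in terms of a sorted frame. -/
def simple (K : Type*) [Field K] [Module K M] (f : Fin m → M) (p : Fin m) : M :=
  if h : (p : ℕ) + 1 < m then f p - f ⟨p + 1, h⟩ else (2 : K) • f p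

/-- A simple root has height one. By the gaps in `η`, a long root `2 f p` of height one has `p`
last, `f p - f q` of height one has `q = p + 1`, and `f p + f q` is too high. -/
lemma exists_root_eq_simple {j : ι} (hj : j ∈ b.support) : ∃ p, P.root j = simple K f p := by
  have h1 := b.height_one_of_mem_support hj
  rcases hf.root_cases j with ⟨p, h | h⟩ | ⟨p, q, hpq, h | h | h⟩
  · refine ⟨p, ?_⟩
    rw [simple, dif_neg, h]
    intro hp
    have h₁ := hf.two_le_sub (p := p) (q := ⟨p + 1, hp⟩) (by simp [Fin.lt_def])
    have h₂ := hf.pos ⟨p + 1, hp⟩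
    have h₃ := hf.height_long j p h
    omega
  · exfalso
    obtain ⟨i, hi⟩ := hf.exists_long p
    rw [← hi] at h
    have h₁ := b.height_eq_neg h
    have h₂ := hf.height_long i p hi
    have h₃ := hf.pos p
    omega
  · have h₁ := hf.height_sub h
    have hlt : p < q := by
      by_contra hle
      have := hf.two_le_sub (lt_of_le_of_ne (not_lt.1 hle) hpq.symm)
      omega
    have hp : (p : ℕ) + 1 < m := by have := Fin.lt_def.1 hlt; omega
    have hq : q = ⟨p + 1, hp⟩ := by
      by_contra hne
      have hlt' : (⟨p + 1, hp⟩ : Fin m) < q :=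
        lt_of_le_of_ne (by rw [Fin.le_def]; exact Fin.lt_def.1 hlt) (Ne.symm hne)
      have h₂ := hf.two_le_sub hlt'
      have h₃ := hf.two_le_sub (p := p) (q := ⟨p + 1, hp⟩) (by simp [Fin.lt_def])
      omega
    exact ⟨p, by rw [simple, dif_pos hp, h, hq]⟩
  · exfalso
    have h₁ := hf.height_add hpq h
    have h₂ := hf.pos p
    have h₃ := hf.pos q
    rcases lt_or_gt_of_ne hpq with h' | h' <;> have := hf.two_le_sub h' <;> omega
  · exfalso
    obtain ⟨i, hi⟩ := hf.exists_add p q hpq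
    rw [← hi] at h
    have h₀ := b.height_eq_neg h
    have h₁ := hf.height_add hpq hi
    have h₂ := hf.pos p
    have h₃ := hf.pos q
    omega

/-- Frame and simple roots are both bases, so counting turns the injection of simple roots into
indices into a bijection. -/
lemma exists_equiv [P.IsRootSystem] :
    ∃ e : Fin m ≃ b.support, ∀ p, P.root (e p) = simple K f p := by
  choose g hg using fun j : b.support ↦ hf.exists_root_eq_simple j.2
  have hinj : Function.Injective g := by
    intro i j hij
    apply Subtype.ext
    apply P.root.injective
    rw [hg, hg, hij]
  have hcard : Fintype.card b.support = Fintype.card (Fin m) := by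
    rw [← finrank_eq_card_basis b.toWeightBasis,
      ← finrank_eq_card_basis (Basis.mk hf.toIsFrame.linearIndependent hf.top_le_span)]
  let e := Equiv.ofBijective g ((Fintype.bijective_iff_injective_and_card g).2 ⟨hinj, hcard⟩)
  refine ⟨e.symm, fun p ↦ ?_⟩
  rw [hg]
  exact congrArg _ (e.apply_symm_apply p)

lemma coroot'_simple {i : ι} {p : Fin m} (hi : P.root i = simple K f p) (r : Fin m) :
    P.coroot' i (f r) = (if r = p then 1 else 0) - if (r : ℕ) = p + 1 then 1 else 0 := by
  unfold simple at hi
  split_ifs at hi with h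
  · rw [hf.coroot_sub i p _ (by simp [Fin.ext_iff]) hi]
    simp only [Fin.ext_iff]
  -- Here `p` is the last index, so no `r` equals `p + 1` and one formula serves both root lengths.
  · rw [hf.coroot_long i p hi, if_neg (c := (r : ℕ) = p + 1) (by omega), sub_zero]

lemma pairingIn_eq_cartanMatrix [P.IsCrystallographic] {i j : ι} {p q : Fin m}
    (hi : P.root i = simple K f p) (hj : P.root j = simple K f q) :
    P.pairingIn ℤ i j = CartanMatrix.C m p q := by
  have h : (P.pairingIn ℤ i j : K) = (CartanMatrix.C m p q : ℤ) := by
    rw [← pairing_eq_intCast, ← root_coroot'_eq_pairing, hi]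
    unfold simple
    split_ifs with h
    · rw [map_sub, hf.coroot'_simple hj, hf.coroot'_simple hj]
      simp only [CartanMatrix.C, Matrix.of_apply, Fin.ext_iff]
      split_ifs <;> first | omega | norm_num
    · rw [map_smul, hf.coroot'_simple hj]
      simp only [CartanMatrix.C, Matrix.of_apply, Fin.ext_iff]
      split_ifs <;> first | omega | norm_num
  exact_mod_cast h

/-- The difference splits into two terms of the form `f 0 ± f p`, each zero or a positive root. -/
lemma two_smul_sub_root_mem_closure [Finite ι] [P.IsCrystallographic] (hm : 0 < m)
    (i : ι) : (2 : K) • f ⟨0, hm⟩ - P.root i ∈ AddSubmonoid.closure (P.root '' b.support) := by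
  have hsub : ∀ p, f ⟨0, hm⟩ - f p ∈ AddSubmonoid.closure (P.root '' b.support) := by
    intro p
    by_cases hp : ⟨0, hm⟩ = p
    · rw [hp, sub_self]; exact zero_mem _
    · obtain ⟨i, hi⟩ := hf.exists_sub _ _ hp
      rw [← hi]
      apply Base.IsPos.root_mem_closure
      have h₁ := hf.height_sub hi
      have h₂ := hf.two_le_sub (p := ⟨0, hm⟩) (q := p)
        (lt_of_le_of_ne (by simp [Fin.le_def]) hp)
      rw [Base.isPos_iff]
      omega
  have hadd : ∀ p, f ⟨0, hm⟩ + f p ∈ AddSubmonoid.closure (P.root '' b.support) := by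
    intro p
    by_cases hp : ⟨0, hm⟩ = p
    · obtain ⟨i, hi⟩ := hf.exists_long p
      rw [hp, ← two_smul K, ← hi]
      apply Base.IsPos.root_mem_closure
      rw [Base.isPos_iff, hf.height_long i p hi]
      exact hf.pos p
    · obtain ⟨i, hi⟩ := hf.exists_add _ _ hp
      rw [← hi]
      apply Base.IsPos.root_mem_closure
      have h₁ := hf.height_add hp hi
      have h₂ := hf.pos ⟨0, hm⟩
      have h₃ := hf.pos p
      rw [Base.isPos_iff]
      omega
  rcases hf.root_cases i with ⟨p, h | h⟩ | ⟨p, q, -, h | h | h⟩ <;> rw [h]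
  · convert add_mem (hsub p) (hsub p) using 1; module
  · convert add_mem (hadd p) (hadd p) using 1; module
  · convert add_mem (hsub p) (hadd q) using 1; module
  · convert add_mem (hsub p) (hsub q) using 1; module
  · convert add_mem (hadd p) (hadd q) using 1; module

end IsSortedFrame

end RootPairing

end

/-! ### From the type C Cartan matrix back to a root -/

noncomputable section

namespace RootPairing

open Module Set

variable {ι K M N : Type*} [Field K] [CharZero K] [AddCommGroup M] [Module K M]
  [AddCommGroup N] [Module K N] {P : RootPairing ι K M N}

/-- In type `Cₙ` some root is twice the first fundamental weight. -/
lemma exists_root_eq_two_mul_fundamental [P.IsCrystallographic] {n : ℕ} (hn : 0 < n)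
    (a : Fin n → ι) (ha : ∀ i j, P.pairingIn ℤ (a i) (a j) = CartanMatrix.C n i j) :
    ∃ i, ∀ j : Fin n, P.pairingIn ℤ i (a j) = if (j : ℕ) = 0 then 2 else 0 := by
  -- The pairings prescribed are those of `2 f t` in type C coordinates. Descend from `t = n - 1`,
  -- the long simple root: reflecting in the simple root `a t` sends `2 f (t + 1)` to `2 f t`.
  suffices h : ∀ d t : ℕ, t + d + 1 = n → ∃ i, ∀ j : Fin n,
      P.pairingIn ℤ i (a j) = if (j : ℕ) = t then 2 else if (j : ℕ) + 1 = t then -2 else 0 by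
    obtain ⟨i, hi⟩ := h (n - 1) 0 (by omega)
    exact ⟨i, fun j ↦ by rw [hi]; simp⟩
  intro d
  induction d with
  | zero =>
    intro t ht
    refine ⟨a ⟨t, by omega⟩, fun j ↦ ?_⟩
    rw [ha]
    simp only [CartanMatrix.C, Matrix.of_apply, Fin.ext_iff]
    split_ifs <;> omega
  | succ d ih =>
    intro t ht
    obtain ⟨i, hi⟩ := ih (t + 1) (by omega)
    have hi' := hi ⟨t, by omega⟩
    simp only [Nat.left_eq_add, one_ne_zero, if_false, if_true] at hi'
    refine ⟨P.reflectionPerm (a ⟨t, by omega⟩) i, fun j ↦ ?_⟩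
    have hroot : P.root (P.reflectionPerm (a ⟨t, by omega⟩) i) =
        (1 : ℤ) • P.root i + (2 : ℤ) • P.root (a ⟨t, by omega⟩) := by
      rw [root_reflectionPerm, reflection_apply_root, pairing_eq_intCast, hi']
      module
    rw [pairingIn_eq_add_of_root_eq_smul_add_smul (S := ℤ) hroot, hi, ha]
    simp only [CartanMatrix.C, Matrix.of_apply, Fin.ext_iff, smul_eq_mul]
    split_ifs <;> omega

omit [CharZero K] in
lemma exists_two_smul_eq {μ ω : M} {w : P.weylGroup} {k l : ℤ} (hl : l = k ∨ l = -k) {i j : ι}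
    (hi : P.root i = (2 : ℤ) • ω) (hw : w • μ = ω + l • P.root j) :
    ∃ α β, (2 : ℤ) • μ = (2 * k) • P.root α + P.root β := by
  have h : (2 : ℤ) • μ =
      (2 * l) • P.root (P.weylGroupToPerm w⁻¹ j) + P.root (P.weylGroupToPerm w⁻¹ i) := by
    rw [← weylGroup_apply_root, ← weylGroup_apply_root, hi, ← weylGroup_smul_zsmul, ← smul_add,
      eq_inv_smul_iff, weylGroup_smul_zsmul, hw, smul_add, smul_smul, add_comm]
  rcases hl with rfl | rfl
  · exact ⟨_, _, h⟩
  -- For `l = -k` the sign is absorbed by replacing the root with its negative.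
  · refine ⟨P.reflectionPerm (P.weylGroupToPerm w⁻¹ j) (P.weylGroupToPerm w⁻¹ j),
      P.weylGroupToPerm w⁻¹ i, ?_⟩
    rw [h, root_reflectionPerm, reflection_apply_self, mul_neg, neg_smul, smul_neg]

end RootPairing

/-! ### Translation to weights of the Lie algebra -/

namespace SimpleWeights

open LieAlgebra LieAlgebra.IsKilling Module RootPairing

variable {𝔤 : Type*} [LieRing 𝔤] [LieAlgebra ℂ 𝔤] [FiniteDimensional ℂ 𝔤]

section Killing

variable [IsKilling ℂ 𝔤] {H : LieSubalgebra ℂ 𝔤} [H.IsCartanSubalgebra]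

lemma cartanMatrix_A_one : CartanMatrix.A 1 = CartanMatrix.C 1 := by
  ext i j
  fin_cases i; fin_cases j
  simp [CartanMatrix.A, CartanMatrix.C]

lemma eq_of_forall_coroot_eq (b : (rootSystem H).Base) {n : ℕ} (e : Fin n ≃ b.support)
    {x y : Dual ℂ H}
    (h : ∀ j, x ((rootSystem H).coroot (e j)) = y ((rootSystem H).coroot (e j))) : x = y := by
  refine b.toCoweightBasis.ext fun i ↦ ?_
  rw [b.toCoweightBasis_apply, ← e.apply_symm_apply i]
  exact h _

lemma fundamentalWeight_coroot (b : (rootSystem H).Base) {n : ℕ} (e : Fin n ≃ b.support)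
    (i j : Fin n) :
    fundamentalWeight b (e i) ((rootSystem H).coroot (e j)) = if j = i then 1 else 0 := by
  split_ifs with h
  · rw [h, fundamentalWeight_coroot_self]
  · exact fundamentalWeight_coroot_of_ne _ _ _ (by simpa [eq_comm] using h)

lemma exists_root_eq_two_smul_fundamentalWeight (b : (rootSystem H).Base) {n : ℕ} (hn : 0 < n)
    {e : Fin n ≃ b.support} (he : IsLabelling b (CartanMatrix.C n) e) :
    ∃ i, (rootSystem H).root i = (2 : ℤ) • fundamentalWeight b (e ⟨0, hn⟩) := by
  obtain ⟨i, hi⟩ := exists_root_eq_two_mul_fundamental hn (fun j ↦ (e j : H.root)) he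
  refine ⟨i, eq_of_forall_coroot_eq b e fun j ↦ ?_⟩
  rw [LinearMap.smul_apply, fundamentalWeight_coroot]
  have h := hi j
  have h' : (rootSystem H).root i ((rootSystem H).coroot (e j)) =
      ((rootSystem H).pairingIn ℤ i (e j) : ℂ) := pairing_eq_intCast (P := rootSystem H) i (e j : H.root)
  rw [h', h]
  simp only [Fin.ext_iff]
  split_ifs <;> simp

/-- On each coroot `τ`, `β(τ) = 2 (μ(τ) - k α(τ))` with integral `μ(τ)` and `α(τ)`. -/
lemma isEvenRoot_of_two_smul_eq {μ : Dual ℂ H} (hμ : μ ∈ abstractWeights H) {k : ℤ}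
    {α β : H.root}
    (h : (2 : ℤ) • μ = (2 * k) • (rootSystem H).root α + (rootSystem H).root β) :
    (rootSystem H).IsEvenRoot β := by
  intro γ
  obtain ⟨n, hn⟩ := hμ γ
  have h₁ := congrArg (fun x : Dual ℂ H ↦ x ((rootSystem H).coroot γ)) h
  have hp : ∀ δ : H.root, (rootSystem H).root δ ((rootSystem H).coroot γ) =
      ((rootSystem H).pairingIn ℤ δ γ : ℂ) := fun δ ↦
    pairing_eq_intCast (P := rootSystem H) δ γ
  simp only [LinearMap.add_apply, LinearMap.smul_apply, hn, hp, zsmul_eq_mul] at h₁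
  have h₂ : 2 * n = 2 * k * (rootSystem H).pairingIn ℤ α γ + (rootSystem H).pairingIn ℤ β γ := by
    exact_mod_cast h₁
  exact ⟨n - k * (rootSystem H).pairingIn ℤ α γ, by linarith⟩

lemma IsListedA₁.exists_root {b : (rootSystem H).Base} {l : ℤ} {ν : Dual ℂ H}
    (h : IsListedA₁ b l ν) :
    ∃ (ω : Dual ℂ H) (i j : H.root), (rootSystem H).root i = (2 : ℤ) • ω ∧
      ν = ω + l • (rootSystem H).root j := by
  obtain ⟨e, he, rfl⟩ := h
  rw [cartanMatrix_A_one] at he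
  obtain ⟨i, hi⟩ := exists_root_eq_two_smul_fundamentalWeight b one_pos he
  refine ⟨_, i, i, hi, ?_⟩
  rw [hi]
  change (2 * l + 1) • fundamentalWeight b (e 0) =
    fundamentalWeight b (e 0) + l • (2 : ℤ) • fundamentalWeight b (e 0)
  module

lemma IsListedC.exists_root {b : (rootSystem H).Base} {l : ℤ} {ν : Dual ℂ H}
    (h : IsListedC b l ν) :
    ∃ (ω : Dual ℂ H) (i j : H.root), (rootSystem H).root i = (2 : ℤ) • ω ∧
      ν = ω + l • (rootSystem H).root j := by
  obtain ⟨n, hn, e, he, h⟩ := h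
  obtain ⟨i, hi⟩ := exists_root_eq_two_smul_fundamentalWeight b (by omega) he
  rcases h with h | h | h | ⟨-, β, -, h⟩
  exacts [⟨_, i, _, hi, h⟩, ⟨_, i, _, hi, h⟩, ⟨_, i, _, hi, h⟩, ⟨_, i, β, hi, h⟩]

lemma IsListedC₂.exists_root {b : (rootSystem H).Base} {l : ℤ} {ν : Dual ℂ H}
    (h : IsListedC₂ b l ν) :
    ∃ (ω : Dual ℂ H) (i j : H.root), (rootSystem H).root i = (2 : ℤ) • ω ∧
      ν = ω + l • (rootSystem H).root j := by
  obtain ⟨e, he, h⟩ := h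
  obtain ⟨i, hi⟩ := exists_root_eq_two_smul_fundamentalWeight b two_pos he
  rcases h with h | h | ⟨-, β, -, h⟩
  exacts [⟨_, i, _, hi, h⟩, ⟨_, i, _, hi, h⟩, ⟨_, i, β, hi, h⟩]

section Sorted

variable {b : (rootSystem H).Base} {m : ℕ} {f : Fin m → Dual ℂ H} {η : Fin m → ℤ}
  {e : Fin m ≃ b.support}

lemma isLabelling_of_isSortedFrame (hf : IsSortedFrame b f η)
    (he : ∀ p, (rootSystem H).root (e p) = IsSortedFrame.simple ℂ f p) :
    IsLabelling b (CartanMatrix.C m) e := fun i j ↦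
  hf.pairingIn_eq_cartanMatrix (he i) (he j)

lemma fundamentalWeight_eq_of_isSortedFrame (hf : IsSortedFrame b f η)
    (he : ∀ p, (rootSystem H).root (e p) = IsSortedFrame.simple ℂ f p) (hm : 0 < m) :
    fundamentalWeight b (e ⟨0, hm⟩) = f ⟨0, hm⟩ := by
  refine eq_of_forall_coroot_eq b e fun j ↦ ?_
  rw [fundamentalWeight_coroot]
  have h : f ⟨0, hm⟩ ((rootSystem H).coroot (e j)) = _ := hf.coroot'_simple (he j) ⟨0, hm⟩
  rw [h]
  simp [eq_comm]

lemma isListed_of_isRepresentative (hf : IsSortedFrame b f η)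
    (he : ∀ p, (rootSystem H).root (e p) = IsSortedFrame.simple ℂ f p) (hm : 0 < m)
    {x ν : Dual ℂ H} (hx : IsFrame.IsRepresentative (K := ℂ) f hm x) {l : ℤ}
    (hν : ν = f ⟨0, hm⟩ + l • x) :
    IsListedA₁ b l ν ∨ IsListedC b l ν ∨ IsListedC₂ b l ν := by
  have hlab := isLabelling_of_isSortedFrame hf he
  have hω := fundamentalWeight_eq_of_isSortedFrame hf he hm
  have hodd : x = (2 : ℂ) • f ⟨0, hm⟩ → ν = (2 * l + 1) • f ⟨0, hm⟩ := by
    rintro rfl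
    rw [hν]
    module
  have hmax : x = (2 : ℂ) • f ⟨0, hm⟩ → ν = (2 * l + 1) • f ⟨0, hm⟩ ∧
      ∃ β : H.root, IsHighestRoot b β ∧ ν = f ⟨0, hm⟩ + l • (rootSystem H).root β := by
    intro h
    obtain ⟨β, hβ⟩ := hf.exists_long ⟨0, hm⟩
    refine ⟨hodd h, β, fun γ ↦ ?_, by rw [hν, h, hβ]⟩
    rw [hβ]
    exact hf.two_smul_sub_root_mem_closure hm γ
  -- Rank one leaves only `2 f 0`; in rank two `f 1 - f 2` is missing and `2 f 1` is `α₂`.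
  rcases (by omega : m = 1 ∨ m = 2 ∨ 3 ≤ m) with rfl | rfl | h3
  · refine .inl ⟨e, cartanMatrix_A_one ▸ hlab, ?_⟩
    rcases hx with h | ⟨h, -⟩ | ⟨h, -⟩ | ⟨h, -⟩
    · exact (hodd h).trans (by rw [← hω]; rfl)
    all_goals omega
  · refine .inr (.inr ⟨e, hlab, ?_⟩)
    change ν = fundamentalWeight b (e ⟨0, hm⟩) + _ ∨ ν = fundamentalWeight b (e ⟨0, hm⟩) + _ ∨
      ν = _ • fundamentalWeight b (e ⟨0, hm⟩) ∧ ∃ β, IsHighestRoot b β ∧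
        ν = fundamentalWeight b (e ⟨0, hm⟩) + _
    rw [hω]
    rcases hx with h | ⟨_, h⟩ | ⟨h, -⟩ | ⟨-, h⟩
    · exact .inr (.inr (hmax h))
    · refine .inl ?_
      rw [he, IsSortedFrame.simple, dif_pos (by simp), hν, h]
      rfl
    · omega
    · refine .inr (.inl ?_)
      rw [he, IsSortedFrame.simple, dif_neg (by simp), hν, h]
      rfl
  · refine .inr (.inl ⟨m, h3, e, hlab, ?_⟩)
    rw [hω]
    rcases hx with h | ⟨h1, h⟩ | ⟨h2, h⟩ | ⟨h1, h⟩
    · exact .inr (.inr (.inr (hmax h)))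
    · refine .inl ?_
      rw [he, IsSortedFrame.simple, dif_pos h1, hν, h]
    · refine .inr (.inl ?_)
      rw [he, IsSortedFrame.simple, dif_pos h2, hν, h]
    · refine .inr (.inr (.inl ?_))
      rw [he, IsSortedFrame.simple, dif_neg (by simp only; omega), hν, h]

end Sorted

end Killing

end SimpleWeights

end

open LieAlgebra LieAlgebra.IsKilling Module SimpleWeights in
theorem proposition9p2 {𝔤 : Type*} [LieRing 𝔤] [LieAlgebra ℂ 𝔤] [FiniteDimensional ℂ 𝔤]
    [LieAlgebra.IsSimple ℂ 𝔤] (H : LieSubalgebra ℂ 𝔤) [H.IsCartanSubalgebra]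
    (b : (rootSystem H).Base) (μ : Dual ℂ H) (hμ : μ ∈ abstractWeights H) :
    (∀ k : ℤ,
      (∃ α β : H.root,
        (2 : ℤ) • μ = (2 * k) • (rootSystem H).root α + (rootSystem H).root β) ↔
      ∃ w : (rootSystem H).weylGroup, ∃ l : ℤ, (l = k ∨ l = -k) ∧
        (IsListedA₁ b l (w • μ) ∨ IsListedC b l (w • μ) ∨ IsListedC₂ b l (w • μ))) ∧
    ((∃ β : H.root, (2 : ℤ) • μ = (rootSystem H).root β) ↔
      ∃ w : (rootSystem H).weylGroup,
        (∃ e : Fin 1 ≃ b.support, IsLabelling b (CartanMatrix.A 1) e ∧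
          w • μ = fundamentalWeight b (e 0)) ∨
        (∃ (n : ℕ) (hn : 2 ≤ n) (e : Fin n ≃ b.support),
          IsLabelling b (CartanMatrix.C n) e ∧
          w • μ = fundamentalWeight b (e ⟨0, by omega⟩))) := by
  refine ⟨fun k ↦ ⟨?_, ?_⟩, ?_, ?_⟩
  · rintro ⟨α, β, h⟩
    have hβ := isEvenRoot_of_two_smul_eq hμ h
    obtain ⟨m, hm, f, η, hf⟩ := RootPairing.exists_isSortedFrame b hβ
    obtain ⟨e, he⟩ := hf.exists_equiv
    obtain ⟨w, l, hl, x, hx, hw⟩ := hf.toIsFrame.exists_normal_form hm hβ h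
    exact ⟨w, l, hl, isListed_of_isRepresentative hf he hm hx hw⟩
  · rintro ⟨w, l, hl, h⟩
    obtain ⟨ω, i, j, hi, hw⟩ : ∃ (ω : Dual ℂ H) (i j : H.root),
        (rootSystem H).root i = (2 : ℤ) • ω ∧ w • μ = ω + l • (rootSystem H).root j := by
      rcases h with h | h | h
      exacts [h.exists_root, h.exists_root, h.exists_root]
    exact RootPairing.exists_two_smul_eq hl hi hw
  · rintro ⟨β, h⟩
    -- With `k = 0` the choice of `α` is immaterial; `β` is a root at hand.
    replace h : (2 : ℤ) • μ = (2 * 0 : ℤ) • (rootSystem H).root β + (rootSystem H).root β := by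
      rw [h]; simp
    have hβ := isEvenRoot_of_two_smul_eq hμ h
    obtain ⟨m, hm, f, η, hf⟩ := RootPairing.exists_isSortedFrame b hβ
    obtain ⟨e, he⟩ := hf.exists_equiv
    obtain ⟨w, l, hl, x, -, hw⟩ := hf.toIsFrame.exists_normal_form hm hβ h
    have hlab := isLabelling_of_isSortedFrame hf he
    obtain rfl : l = 0 := by omega
    rw [zero_smul, add_zero, ← fundamentalWeight_eq_of_isSortedFrame hf he hm] at hw
    refine ⟨w, ?_⟩
    rcases (by omega : m = 1 ∨ 2 ≤ m) with rfl | h2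
    · exact .inl ⟨e, cartanMatrix_A_one ▸ hlab, hw⟩
    · exact .inr ⟨m, h2, e, hlab, hw⟩
  · rintro ⟨w, h⟩
    obtain ⟨n, hn, e, he, hw⟩ : ∃ (n : ℕ) (hn : 0 < n) (e : Fin n ≃ b.support),
        IsLabelling b (CartanMatrix.C n) e ∧ w • μ = fundamentalWeight b (e ⟨0, hn⟩) := by
      rcases h with ⟨e, he, hw⟩ | ⟨n, hn, e, he, hw⟩
      · exact ⟨1, one_pos, e, cartanMatrix_A_one ▸ he, hw⟩
      · exact ⟨n, by omega, e, he, hw⟩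
    obtain ⟨i, hi⟩ := exists_root_eq_two_smul_fundamentalWeight b hn he
    have hw' : w • μ = fundamentalWeight b (e ⟨0, hn⟩) + (0 : ℤ) • (rootSystem H).root i := by
      rw [hw, zero_smul, add_zero]
    obtain ⟨α, β, h⟩ := RootPairing.exists_two_smul_eq (k := 0) (.inl rfl) hi hw'
    exact ⟨β, by simpa using h⟩
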